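/- Let $\mathbb{D}=\{z\in\mathbb{C}:|z|<1\}$, and let $\psi$ be analytic and univalent in $\mathbb{D}$ with $\psi(0)=1$ and $\operatorname{Re}\psi>0$ in $\mathbb{D}$. Let $\mathcal{S}^*(\psi)$ be the class of all analytic functions $h$ in $\mathbb{D}$ with $h(0)=0$, $h'(0)=1$ and $zh'(z)/h(z)\prec\psi(z)$, that is, $zh'(z)/h(z)=\psi(\omega(z))$ in $\mathbb{D}$ for some analytic $\omega:\mathbb{D}\to\mathbb{D}$ with $\omega(0)=0$ (the left side being $1$ at $z=0$). Let $r_c$ be the radius of convexity of $\mathcal{S}^*(\psi)$, i.e. the largest $r\le 1$ such that every $h\in\mathcal{S}^*(\psi)$ maps $|z|<r$ univalently onto a convex set. A domain $\Omega\subset\mathbb{C}$ is called close-to-convex if $\mathbb{C}\setminus\Omega$ is a union of closed half-lines whose corresponding open half-lines are pairwise disjoint. Theorem. Put $$H_\psi(r)=\inf\Big\{\operatorname{Re}\Big(1+\frac{zh''(z)}{h'(z)}\Big): |z|=r,\ h\in\mathcal{S}^*(\psi)\Big\},\qquad 0<r<1.$$ Then the equation $(1-r)H_\psi(r)-r=0$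 has a smallest root $r_0$ in $(0,1)$, and the following holds. If $h\in\mathcal{S}^*(\psi)$, $\varphi:\mathbb{D}\to\mathbb{D}$ is analytic, and $g$ is analytic in $\mathbb{D}$ with $g'=\varphi h'$, then the harmonic function $f=h+\overline{g}$ is univalent and close-to-convex in $|z|<\min\{r_0,r_c\}$; that is, $f$ is injective and sense-preserving (has positive Jacobian) in this disk and maps it onto a close-to-convex domain. Moreover, for each individual $h\in\mathcal{S}^*(\psi)$ the same is true with $H_\psi(r)$ replaced by $\min_{|z|=r}\operatorname{Re}\left(1+zh''(z)/h'(z)\right)$ for this $h$, and with $r_0$ replaced by the smallest root in $(0,1)$ of the corresponding equation. -/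

import Mathlib

open Set Metric

namespace MaMinda

/-- The open unit disk. -/
abbrev unitDisk : Set ℂ := ball 0 1

/-- `ψ` is analytic and univalent in the unit disk, `ψ(0) = 1`, and has positive real part. -/
structure IsMaMindaFunction (ψ : ℂ → ℂ) : Prop where
  analytic : DifferentiableOn ℂ ψ unitDisk
  univalent : InjOn ψ unitDisk
  map_zero : ψ 0 = 1
  re_pos : ∀ z ∈ unitDisk, 0 < (ψ z).re

/-- Subordination `F ≺ G` in the unit disk: `F = G ∘ ω` for an analytic self-map `ω` of the disk
with `ω(0) = 0`. -/
def Subordinate (F G : ℂ → ℂ) : Prop :=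
  ∃ ω : ℂ → ℂ, DifferentiableOn ℂ ω unitDisk ∧ MapsTo ω unitDisk unitDisk ∧ ω 0 = 0 ∧
    ∀ z ∈ unitDisk, F z = G (ω z)

/-- The class `𝒜`: analytic in the unit disk with `h(0) = 0`, `h'(0) = 1`. -/
def classA : Set (ℂ → ℂ) :=
  {h | DifferentiableOn ℂ h unitDisk ∧ h 0 = 0 ∧ deriv h 0 = 1}

/-- The function `z h'(z) / h(z)`, with its removable singularity at `0` filled in by the
value `1`, its limit there for `h ∈ 𝒜`. -/
noncomputable def starQuotient (h : ℂ → ℂ) : ℂ → ℂ :=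
  Function.update (fun z => z * deriv h z / h z) 0 1

/-- The class `𝒮*(ψ)` of functions `h ∈ 𝒜` with `z h'(z) / h(z) ≺ ψ(z)`. -/
def starlikeClass (ψ : ℂ → ℂ) : Set (ℂ → ℂ) :=
  {h | h ∈ classA ∧ Subordinate (starQuotient h) ψ}

/-- `h` is univalent in `|z| < r` and maps this disk onto a convex set. -/
def IsConvexUnivalentOn (h : ℂ → ℂ) (r : ℝ) : Prop :=
  InjOn h (ball 0 r) ∧ Convex ℝ (h '' ball 0 r)

/-- The radius of convexity of `𝒮*(ψ)`: the largest `r ≤ 1` such that all functions of the class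
are convex univalent in `|z| < r`. -/
noncomputable def radiusOfConvexity (ψ : ℂ → ℂ) : ℝ :=
  sSup {r | r ∈ Icc (0 : ℝ) 1 ∧ ∀ h ∈ starlikeClass ψ, IsConvexUnivalentOn h r}

/-- `Re (1 + z h''(z) / h'(z))`. -/
noncomputable def convexityRe (h : ℂ → ℂ) (z : ℂ) : ℝ :=
  (1 + z * deriv (deriv h) z / deriv h z).re

/-- `min_{|z| = r} Re (1 + z h''(z) / h'(z))` for one function `h`. -/
noncomputable def convexityMin (h : ℂ → ℂ) (r : ℝ) : ℝ :=
  sInf (convexityRe h '' sphere 0 r)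

/-- The sharp lower bound of `Re (1 + z h''(z) / h'(z))` over `|z| = r` and all `h ∈ 𝒮*(ψ)`. -/
noncomputable def classConvexityMin (ψ : ℂ → ℂ) (r : ℝ) : ℝ :=
  sInf {x | ∃ h ∈ starlikeClass ψ, ∃ z ∈ sphere (0 : ℂ) r, x = convexityRe h z}

/-- `r₀` is the smallest root in `(0, 1)` of `(1 - r) H(r) - r = 0`. -/
def IsMinimalRoot (H : ℝ → ℝ) (r₀ : ℝ) : Prop :=
  IsLeast {r : ℝ | r ∈ Ioo (0 : ℝ) 1 ∧ (1 - r) * H r - r = 0} r₀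

/-- The closed half-line from `a` in the direction `d`. -/
def closedHalfLine (a d : ℂ) : Set ℂ := (fun t : ℝ => a + t * d) '' Ici 0

/-- The open half-line from `a` in the direction `d`. -/
def openHalfLine (a d : ℂ) : Set ℂ := (fun t : ℝ => a + t * d) '' Ioi 0

/-- A close-to-convex domain: its complement is a union of closed half-lines whose corresponding
open half-lines are pairwise disjoint. Half-lines are given by origin and unit direction, so
distinct pairs are distinct half-lines. -/
def IsCloseToConvexDomain (Ω : Set ℂ) : Prop :=
  IsOpen Ω ∧ IsPreconnected Ω ∧
    ∃ S : Set (ℂ × ℂ), (∀ p ∈ S, ‖p.2‖ = 1) ∧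
      Ωᶜ = ⋃ p ∈ S, closedHalfLine p.1 p.2 ∧
      S.PairwiseDisjoint fun p => openHalfLine p.1 p.2

/-- `f` is a univalent, sense-preserving (positive Jacobian) harmonic mapping of `U` onto a
close-to-convex domain. -/
structure IsUnivalentCloseToConvexOn (f : ℂ → ℂ) (U : Set ℂ) : Prop where
  harmonic : InnerProductSpace.HarmonicOnNhd f U
  univalent : InjOn f U
  sense_preserving : ∀ z ∈ U, 0 < (fderiv ℝ f z).det
  closeToConvex : IsCloseToConvexDomain (f '' U)

end MaMinda

/-!
Let `Ω = h(|z| < ρ)`, which is convex for `ρ ≤ r_c`. If `ρ < 1`, compactness gives `k < 1` with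
`|g'| ≤ k |h'|` on `|z| < ρ`, so that `f ∘ h⁻¹ = id + T` on `Ω`, where `T` is the conjugate of
`g ∘ h⁻¹` and is a `k`-contraction because `Ω` is convex. This gives injectivity. Extending `T` to
the closure of `Ω` and composing it with the nearest-point projection `π` yields a homeomorphism
`id + T ∘ π` of the plane. The outer normal half-lines of `Ω` fill its complement, and `T ∘ π` is
constant on each of them, so the homeomorphism translates each one rigidly; the translated
half-lines fill the complement of `f(|z| < ρ)`.

As for the roots, `p = z h' / h` is a Carathéodory function and `1 + z h'' / h' = p + z p' / p`.
Cauchy estimates bound this quotient and its derivative on compact discs uniformly over the class,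
so the infimum `H` is continuous with `H(0) = 1`. The minimum principle gives `H(1/2) ≤ 1`, hence
`(1 - r) H(r) - r` changes sign on `[0, 1/2]`.
-/

namespace MaMinda

open Filter Topology NNReal

section ConvexSets

variable {E : Type*} [NormedAddCommGroup E] [InnerProductSpace ℝ E]

/-- `P` is the nearest-point projection onto `K`, encoded by the variational inequality that
characterizes the nearest point of a convex set. -/
def IsMetricProjection (K : Set E) (P : E → E) : Prop :=
  ∀ x, P x ∈ K ∧ ∀ w ∈ K, inner ℝ (x - P x) (w - P x) ≤ 0

theorem exists_isMetricProjection [CompleteSpace E] {K : Set E} (hK : Convex ℝ K)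
    (hc : IsClosed K) (hne : K.Nonempty) : ∃ P, IsMetricProjection K P := by
  choose P hPK hP using exists_norm_eq_iInf_of_complete_convex hne hc.isComplete hK
  exact ⟨P, fun x => ⟨hPK x, (norm_eq_iInf_iff_real_inner_le_zero hK (hPK x)).1 (hP x)⟩⟩

theorem norm_sub_le_of_inner_sub_nonpos {p q x y : E} (hp : inner ℝ (x - p) (q - p) ≤ 0)
    (hq : inner ℝ (y - q) (p - q) ≤ 0) : ‖p - q‖ ≤ ‖x - y‖ := by
  have hsq : ‖p - q‖ * ‖p - q‖ ≤ ‖x - y‖ * ‖p - q‖ := calc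
    ‖p - q‖ * ‖p - q‖
      = inner ℝ (x - y) (p - q) + inner ℝ (x - p) (q - p) + inner ℝ (y - q) (p - q) := by
        rw [← real_inner_self_eq_norm_mul_norm]
        simp only [inner_sub_left, inner_sub_right]
        ring
    _ ≤ inner ℝ (x - y) (p - q) := by linarith
    _ ≤ ‖x - y‖ * ‖p - q‖ := real_inner_le_norm _ _
  rcases (norm_nonneg (p - q)).eq_or_lt with h | h
  · exact h ▸ norm_nonneg _
  · exact le_of_mul_le_mul_right hsq h

namespace IsMetricProjection

variable {K : Set E} {P : E → E}

theorem lipschitzWith_one (hP : IsMetricProjection K P) : LipschitzWith 1 P :=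
  LipschitzWith.mk_one fun x y => by
    simpa only [dist_eq_norm] using
      norm_sub_le_of_inner_sub_nonpos ((hP x).2 _ (hP y).1) ((hP y).2 _ (hP x).1)

theorem apply_eq_of_inner_nonpos (hP : IsMetricProjection K P) {p x : E} (hp : p ∈ K)
    (hx : ∀ w ∈ K, inner ℝ (x - p) (w - p) ≤ 0) : P x = p := by
  simpa [sub_eq_zero] using norm_sub_le_of_inner_sub_nonpos ((hP x).2 p hp) (hx _ (hP x).1)

theorem apply_of_mem (hP : IsMetricProjection K P) {x : E} (hx : x ∈ K) : P x = x :=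
  hP.apply_eq_of_inner_nonpos hx (by simp)

end IsMetricProjection

/-- The unit normal bundle of `Ω`: pairs `(w, n)` of a point `w` of the closure and an outer unit
normal `n` to `Ω` at `w`. For open `Ω` such a `w` lies on the boundary. -/
def unitNormals (Ω : Set E) : Set (E × E) :=
  {p | p.1 ∈ closure Ω ∧ ‖p.2‖ = 1 ∧ ∀ v ∈ Ω, inner ℝ p.2 (v - p.1) ≤ 0}

variable {Ω : Set E} {P : E → E} {p q : E × E}

theorem inner_sub_nonpos_of_mem_closure (hp : p ∈ unitNormals Ω) {v : E} (hv : v ∈ closure Ω) :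
    inner ℝ p.2 (v - p.1) ≤ 0 := by
  have hclosed : IsClosed {v : E | inner ℝ p.2 (v - p.1) ≤ 0} :=
    isClosed_le (by fun_prop) continuous_const
  exact closure_minimal hp.2.2 hclosed hv

theorem IsMetricProjection.apply_add_smul (hP : IsMetricProjection (closure Ω) P)
    (hp : p ∈ unitNormals Ω) {t : ℝ} (ht : 0 ≤ t) : P (p.1 + t • p.2) = p.1 := by
  refine hP.apply_eq_of_inner_nonpos hp.1 fun v hv => ?_
  rw [add_sub_cancel_left, real_inner_smul_left]
  exact mul_nonpos_of_nonneg_of_nonpos ht (inner_sub_nonpos_of_mem_closure hp hv)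

theorem add_smul_notMem_of_mem_unitNormals (ho : IsOpen Ω) (hp : p ∈ unitNormals Ω) {t : ℝ}
    (ht : 0 ≤ t) : p.1 + t • p.2 ∉ Ω := fun hmem => by
  have hcont : Tendsto (fun s : ℝ => p.1 + s • p.2) (𝓝[>] t) (𝓝 (p.1 + t • p.2)) :=
    (Continuous.tendsto (by fun_prop) t).mono_left nhdsWithin_le_nhds
  obtain ⟨s, hs, hts⟩ := ((hcont.eventually (ho.mem_nhds hmem)).and self_mem_nhdsWithin).exists
  have hinner := hp.2.2 _ hs
  rw [add_sub_cancel_left, real_inner_smul_right, real_inner_self_eq_norm_sq, hp.2.1] at hinner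
  linarith [show t < s from hts]

theorem exists_unit_inner_sub_nonpos_of_notMem [CompleteSpace E] (hΩ : Convex ℝ Ω)
    (ho : IsOpen Ω) (hne : Ω.Nonempty) {x : E} (hx : x ∉ Ω) :
    ∃ n : E, ‖n‖ = 1 ∧ ∀ v ∈ Ω, inner ℝ n (v - x) ≤ 0 := by
  obtain ⟨f, hf⟩ := geometric_hahn_banach_open_point hΩ ho hx
  obtain ⟨m, rfl⟩ := (InnerProductSpace.toDual ℝ E).surjective f
  simp only [InnerProductSpace.toDual_apply_apply] at hf
  obtain ⟨a, ha⟩ := hne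
  have hm : m ≠ 0 := by
    rintro rfl
    simpa using hf a ha
  refine ⟨‖m‖⁻¹ • m, by simp [norm_smul, hm], fun v hv => ?_⟩
  rw [real_inner_smul_left, inner_sub_right]
  exact mul_nonpos_of_nonneg_of_nonpos (by positivity) (by linarith [hf v hv])

theorem exists_mem_unitNormals_add_smul_eq [CompleteSpace E] (hΩ : Convex ℝ Ω) (ho : IsOpen Ω)
    (hne : Ω.Nonempty) {x : E} (hx : x ∉ Ω) :
    ∃ p ∈ unitNormals Ω, ∃ t : ℝ, 0 ≤ t ∧ p.1 + t • p.2 = x := by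
  by_cases hxc : x ∈ closure Ω
  · obtain ⟨n, hn, hinner⟩ := exists_unit_inner_sub_nonpos_of_notMem hΩ ho hne hx
    exact ⟨(x, n), ⟨hxc, hn, hinner⟩, 0, le_rfl, by simp⟩
  · obtain ⟨P, hP⟩ := exists_isMetricProjection hΩ.closure isClosed_closure hne.closure
    have hxP : x - P x ≠ 0 := sub_ne_zero.2 fun h => hxc (h ▸ (hP x).1)
    refine ⟨(P x, ‖x - P x‖⁻¹ • (x - P x)), ⟨(hP x).1, by simp [norm_smul, hxP], fun v hv => ?_⟩,
      ‖x - P x‖, norm_nonneg _, by simp [smul_smul, hxP]⟩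
    rw [real_inner_smul_left]
    exact mul_nonpos_of_nonneg_of_nonpos (by positivity) ((hP x).2 v (subset_closure hv))

theorem eq_of_smul_eq_smul_of_norm_eq_one {n m : E} (hn : ‖n‖ = 1) (hm : ‖m‖ = 1) {s t : ℝ}
    (hs : 0 < s) (ht : 0 < t) (h : s • n = t • m) : n = m :=
  (sameRay_iff_of_norm_eq (hn.trans hm.symm)).1 (Or.inr (Or.inr ⟨s, t, hs, ht, h⟩))

theorem IsMetricProjection.eq_of_add_smul_eq (hP : IsMetricProjection (closure Ω) P)
    (hp : p ∈ unitNormals Ω) (hq : q ∈ unitNormals Ω) {s t : ℝ} (hs : 0 < s) (ht : 0 < t)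
    (h : p.1 + s • p.2 = q.1 + t • q.2) : p = q := by
  have hfoot : p.1 = q.1 := by
    rw [← hP.apply_add_smul hp hs.le, h, hP.apply_add_smul hq ht.le]
  rw [hfoot, add_left_cancel_iff] at h
  exact Prod.ext hfoot (eq_of_smul_eq_smul_of_norm_eq_one hp.2.1 hq.2.1 hs ht h)

end ConvexSets

section Contractions

variable {k : ℝ≥0}

theorem exists_lipschitzOnWith_closure {X Y : Type*} [PseudoMetricSpace X] [MetricSpace Y]
    [CompleteSpace Y] {T : X → Y} {s : Set X} (hT : LipschitzOnWith k T s) :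
    ∃ T' : X → Y, EqOn T' T s ∧ LipschitzOnWith k T' (closure s) := by
  have hlim : ∀ x ∈ closure s, ∃ y, Tendsto T (𝓝[s] x) (𝓝 y) := fun x hx => by
    have : (𝓝[s] x).NeBot := mem_closure_iff_nhdsWithin_neBot.1 hx
    exact cauchy_map_iff_exists_tendsto.1
      ((cauchy_nhds.mono nhdsWithin_le_nhds).map_of_le hT.uniformContinuousOn inf_le_right)
  have heq : EqOn (extendFrom s T) T s := extendFrom_extends hT.continuousOn
  have hext : LipschitzOnWith k (extendFrom s T) s := fun x hx y hy => by
    rw [heq hx, heq hy]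
    exact hT hx hy
  exact ⟨_, heq, hext.closure (continuousOn_extendFrom subset_rfl hlim)⟩

theorem injOn_add_of_lipschitzOnWith {E : Type*} [NormedAddCommGroup E] {Ω : Set E} {T : E → E}
    (hk : k < 1) (hT : LipschitzOnWith k T Ω) : InjOn (fun w => w + T w) Ω := by
  intro x hx y hy (h : x + T x = y + T y)
  have hdiff : x - y = T y - T x := sub_eq_sub_iff_add_eq_add.2 (by rw [h, add_comm])
  have hle : ‖x - y‖ ≤ k * ‖x - y‖ := by
    calc ‖x - y‖ = ‖T y - T x‖ := by rw [hdiff]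
      _ ≤ k * ‖x - y‖ := by simpa [dist_eq_norm, norm_sub_rev] using hT.dist_le_mul x hx y hy
  exact sub_eq_zero.1 (norm_le_zero_iff.1
    (by nlinarith [norm_nonneg (x - y), NNReal.coe_lt_one.2 hk]))

theorem exists_homeomorph_add_of_lipschitzWith {E : Type*} [NormedAddCommGroup E]
    [NormedSpace ℝ E] [CompleteSpace E] {T : E → E} (hk : k < 1) (hT : LipschitzWith k T) :
    ∃ Φ : E ≃ₜ E, ∀ x, Φ x = x + T x := by
  have happrox : ApproximatesLinearOn (fun x => x + T x)
      (ContinuousLinearEquiv.refl ℝ E : E →L[ℝ] E) univ k := by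
    rw [ApproximatesLinearOn.approximatesLinearOn_iff_lipschitzOnWith, lipschitzOnWith_univ]
    convert hT using 1
    ext x
    simp
  have hsmall : Subsingleton E ∨ k < ‖((ContinuousLinearEquiv.refl ℝ E).symm : E →L[ℝ] E)‖₊⁻¹ := by
    rcases subsingleton_or_nontrivial E with h | h
    · exact Or.inl h
    · rw [ContinuousLinearEquiv.refl_symm, ContinuousLinearEquiv.coe_refl,
        ContinuousLinearMap.nnnorm_id, inv_one]
      exact Or.inr hk
  exact ⟨happrox.toHomeomorph _ hsmall, fun _ => rfl⟩

-- Precomposing the contraction with the nearest-point projection makes it constant along each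
-- normal half-line, so the resulting homeomorphism translates these half-lines rigidly.
theorem exists_homeomorph_translating_normals {E : Type*} [NormedAddCommGroup E]
    [InnerProductSpace ℝ E] [CompleteSpace E] {Ω : Set E} {T P : E → E} (hk : k < 1)
    (hT : LipschitzOnWith k T Ω) (hP : IsMetricProjection (closure Ω) P) :
    ∃ (Φ : E ≃ₜ E) (τ : E → E), EqOn Φ (fun w => w + T w) Ω ∧
      ∀ p ∈ unitNormals Ω, ∀ t : ℝ, 0 ≤ t → Φ (p.1 + t • p.2) = p.1 + τ p.1 + t • p.2 := by
  obtain ⟨T', hT'T, hT'⟩ := exists_lipschitzOnWith_closure hT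
  have hlip : LipschitzWith k (T' ∘ P) := by
    rw [← lipschitzOnWith_univ, ← mul_one k]
    exact hT'.comp hP.lipschitzWith_one.lipschitzOnWith fun x _ => (hP x).1
  obtain ⟨Φ, hΦ⟩ := exists_homeomorph_add_of_lipschitzWith hk hlip
  refine ⟨Φ, T', fun w hw => ?_, fun p hp t ht => ?_⟩
  · simp only [hΦ, Function.comp_apply, hP.apply_of_mem (subset_closure hw), hT'T hw]
  · rw [hΦ, Function.comp_apply, hP.apply_add_smul hp ht, add_right_comm]

end Contractions

section CloseToConvexDomains

theorem isCloseToConvexDomain_empty : IsCloseToConvexDomain ∅ := by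
  refine ⟨isOpen_empty, isPreconnected_empty, {p | p.1 = 0 ∧ ‖p.2‖ = 1}, fun p hp => hp.2, ?_, ?_⟩
  · refine compl_empty.trans (eq_univ_of_forall fun z => ?_).symm
    obtain ⟨d, hd, hz⟩ : ∃ d : ℂ, ‖d‖ = 1 ∧ (‖z‖ : ℂ) * d = z :=
      ⟨_, Complex.norm_exp_ofReal_mul_I z.arg, Complex.norm_mul_exp_arg_mul_I z⟩
    exact mem_biUnion (x := (0, d)) ⟨rfl, hd⟩ ⟨‖z‖, norm_nonneg z, by simpa using hz⟩
  · rintro ⟨_, d⟩ ⟨rfl, hd⟩ ⟨_, d'⟩ ⟨rfl, hd'⟩ hne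
    refine Set.disjoint_left.2 ?_
    rintro _ ⟨s, hs, rfl⟩ ⟨t, ht, h⟩
    refine hne (congrArg (Prod.mk 0) (eq_of_smul_eq_smul_of_norm_eq_one hd hd' hs ht ?_))
    simpa using h.symm

theorem isCloseToConvexDomain_image_add {Ω : Set ℂ} {T : ℂ → ℂ} {k : ℝ≥0} (hΩ : Convex ℝ Ω)
    (ho : IsOpen Ω) (hk : k < 1) (hT : LipschitzOnWith k T Ω) :
    IsCloseToConvexDomain ((fun w => w + T w) '' Ω) := by
  rcases Ω.eq_empty_or_nonempty with rfl | hne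
  · rw [image_empty]
    exact isCloseToConvexDomain_empty
  obtain ⟨P, hP⟩ := exists_isMetricProjection hΩ.closure isClosed_closure hne.closure
  obtain ⟨Φ, τ, hΦΩ, hΦ⟩ := exists_homeomorph_translating_normals hk hT hP
  have hpre := hΩ.isPreconnected.image _ (continuousOn_id.add hT.continuousOn)
  simp only [Complex.real_smul] at hΦ
  rw [← hΦΩ.image_eq]
  refine ⟨Φ.isOpenMap _ ho, hΦΩ.image_eq ▸ hpre,
    (fun p => (p.1 + τ p.1, p.2)) '' unitNormals Ω, ?_, ?_, ?_⟩
  · rintro _ ⟨p, hp, rfl⟩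
    exact hp.2.1
  · rw [← image_compl_eq Φ.bijective, biUnion_image]
    refine Subset.antisymm ?_ (iUnion₂_subset fun p hp => ?_)
    · rintro _ ⟨x, hx, rfl⟩
      obtain ⟨p, hp, t, ht, rfl⟩ := exists_mem_unitNormals_add_smul_eq hΩ ho hne hx
      exact mem_biUnion hp ⟨t, ht, by rw [Complex.real_smul, hΦ p hp t ht]⟩
    · rintro _ ⟨t, ht, rfl⟩
      exact ⟨_, add_smul_notMem_of_mem_unitNormals ho hp ht, hΦ p hp t ht⟩
  · rintro _ ⟨p, hp, rfl⟩ _ ⟨q, hq, rfl⟩ hne'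
    refine Set.disjoint_left.2 ?_
    rintro _ ⟨s, hs, rfl⟩ ⟨t, ht, h⟩
    refine hne' (congrArg (fun p : ℂ × ℂ => (p.1 + τ p.1, p.2))
      (hP.eq_of_add_smul_eq hp hq hs ht (Φ.injective ?_)))
    simp only [Complex.real_smul]
    rw [hΦ p hp s (le_of_lt hs), hΦ q hq t (le_of_lt ht)]
    exact h.symm

end CloseToConvexDomains

section MinimalRoots

/-- The infimum over the sphere of radius `r` of all members of a family of functions; this is
`classConvexityMin` and `convexityMin` for suitable families of functions `convexityRe h`. -/
noncomputable def sphereInf {E : Type*} [NormedAddCommGroup E] (𝓕 : Set (E → ℝ)) (r : ℝ) : ℝ :=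
  sInf {x | ∃ u ∈ 𝓕, ∃ z ∈ sphere (0 : E) r, x = u z}

variable {E : Type*} [NormedAddCommGroup E] {𝓕 : Set (E → ℝ)} {c R : ℝ} {L : ℝ≥0}

theorem exists_norm_eq_and_norm_sub_eq [NormedSpace ℝ E] [Nontrivial E] (z : E) {s : ℝ}
    (hs : 0 ≤ s) : ∃ w : E, ‖w‖ = s ∧ ‖w - z‖ = |s - ‖z‖| := by
  rcases eq_or_ne z 0 with rfl | hz
  · obtain ⟨w, hw⟩ := exists_norm_eq E hs
    exact ⟨w, hw, by rw [sub_zero, norm_zero, sub_zero, hw, abs_of_nonneg hs]⟩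
  · have hz' : ‖z‖ ≠ 0 := norm_ne_zero_iff.2 hz
    refine ⟨(s / ‖z‖) • z, by rw [norm_smul, Real.norm_of_nonneg (by positivity),
      div_mul_cancel₀ _ hz'], ?_⟩
    calc ‖(s / ‖z‖) • z - z‖ = ‖(s / ‖z‖ - 1) • z‖ := by rw [sub_smul, one_smul]
      _ = |(s / ‖z‖ - 1) * ‖z‖| := by rw [norm_smul, Real.norm_eq_abs, abs_mul, abs_norm]
      _ = |s - ‖z‖| := by rw [sub_mul, div_mul_cancel₀ _ hz', one_mul]

theorem sphereInf_le (h0 : ∀ u ∈ 𝓕, u 0 = c)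
    (hL : ∀ u ∈ 𝓕, LipschitzOnWith L u (closedBall 0 R)) {u : E → ℝ} (hu : u ∈ 𝓕) {z : E}
    {r : ℝ} (hr : r ≤ R) (hz : z ∈ sphere 0 r) : sphereInf 𝓕 r ≤ u z := by
  refine csInf_le ⟨c - L * r, ?_⟩ ⟨u, hu, z, hz, rfl⟩
  rintro _ ⟨v, hv, w, hw, rfl⟩
  have hwR : w ∈ closedBall 0 R := closedBall_subset_closedBall hr (sphere_subset_closedBall hw)
  have h0R : (0 : E) ∈ closedBall 0 R := mem_closedBall_self (dist_nonneg.trans hwR)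
  simpa [h0 v hv, mem_sphere.1 hw, dist_comm] using
    sub_le_iff_le_add.2 ((hL v hv).le_add_mul h0R hwR)

theorem lipschitzOnWith_sphereInf [NormedSpace ℝ E] [Nontrivial E] (hne : 𝓕.Nonempty)
    (h0 : ∀ u ∈ 𝓕, u 0 = c) (hL : ∀ u ∈ 𝓕, LipschitzOnWith L u (closedBall 0 R)) :
    LipschitzOnWith L (sphereInf 𝓕) (Icc 0 R) := by
  refine LipschitzOnWith.of_le_add_mul L fun s hs r hr => ?_
  obtain ⟨u₀, hu₀⟩ := hne
  obtain ⟨z₀, hz₀⟩ := exists_norm_eq E hr.1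
  rw [← sub_le_iff_le_add]
  refine le_csInf ⟨_, u₀, hu₀, z₀, mem_sphere_zero_iff_norm.2 hz₀, rfl⟩ ?_
  rintro _ ⟨u, hu, z, hz, rfl⟩
  have hzr : ‖z‖ = r := mem_sphere_zero_iff_norm.1 hz
  obtain ⟨w, hw, hwz⟩ := exists_norm_eq_and_norm_sub_eq z hs.1
  rw [sub_le_iff_le_add]
  calc sphereInf 𝓕 s ≤ u w := sphereInf_le h0 hL hu hs.2 (mem_sphere_zero_iff_norm.2 hw)
    _ ≤ u z + L * dist w z := (hL u hu).le_add_mul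
        (mem_closedBall_zero_iff.2 (hw.trans_le hs.2))
        (mem_closedBall_zero_iff.2 (hzr.trans_le hr.2))
    _ = u z + L * dist s r := by rw [dist_eq_norm, hwz, hzr, Real.dist_eq]

theorem sphereInf_zero (hne : 𝓕.Nonempty) (h0 : ∀ u ∈ 𝓕, u 0 = c) : sphereInf 𝓕 0 = c := by
  have hvalues : {x | ∃ u ∈ 𝓕, ∃ z ∈ sphere (0 : E) 0, x = u z} = {c} := by
    obtain ⟨u, hu⟩ := hne
    refine Subset.antisymm ?_ (singleton_subset_iff.2 ⟨u, hu, 0, by simp, (h0 u hu).symm⟩)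
    rintro _ ⟨v, hv, z, hz, rfl⟩
    rw [norm_eq_zero.1 (mem_sphere_zero_iff_norm.1 hz)]
    exact h0 v hv
  rw [sphereInf, hvalues, csInf_singleton]

theorem exists_isMinimalRoot {H : ℝ → ℝ} (hH : ContinuousOn H (Icc 0 (1 / 2))) (h0 : 0 < H 0)
    (h1 : H (1 / 2) ≤ 1) : ∃ r₀, IsMinimalRoot H r₀ := by
  set D : ℝ → ℝ := fun r => (1 - r) * H r - r with hD
  have hDc : ContinuousOn D (Icc 0 (1 / 2)) := by fun_prop
  have hD0 : 0 < D 0 := by simpa [hD] using h0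
  have hD1 : D (1 / 2) ≤ 0 := by simp only [hD]; linarith
  have hcompact : IsCompact (Icc 0 (1 / 2) ∩ D ⁻¹' {0}) :=
    isCompact_Icc.of_isClosed_subset
      (hDc.preimage_isClosed_of_isClosed isClosed_Icc isClosed_singleton) inter_subset_left
  obtain ⟨r₀, ⟨hr₀, hroot⟩, hmin⟩ := hcompact.exists_isLeast
    (intermediate_value_Icc' (by norm_num) hDc ⟨hD1, hD0.le⟩)
  have hr₀0 : r₀ ≠ 0 := fun h => hD0.ne' (h ▸ hroot)
  refine ⟨r₀, ⟨⟨hr₀.1.lt_of_ne' hr₀0, hr₀.2.trans_lt (by norm_num)⟩, hroot⟩, ?_⟩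
  rintro r ⟨hr, hDr⟩
  rcases le_total r (1 / 2) with hle | hge
  · exact hmin ⟨⟨hr.1.le, hle⟩, hDr⟩
  · exact hr₀.2.trans hge

end MinimalRoots

section CauchyEstimates

variable {F : Type*} [NormedAddCommGroup F] [NormedSpace ℂ F] {f : ℂ → F} {c : ℂ} {M R S : ℝ}

theorem norm_deriv_le_of_forall_mem_closedBall_norm_le (hRS : R < S)
    (hf : DifferentiableOn ℂ f (closedBall c S)) (hM : ∀ z ∈ closedBall c S, ‖f z‖ ≤ M) {z : ℂ}
    (hz : z ∈ closedBall c R) : ‖deriv f z‖ ≤ M / (S - R) := by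
  have hsub : closedBall z (S - R) ⊆ closedBall c S :=
    closedBall_subset_closedBall' (by linarith [mem_closedBall.1 hz])
  exact Complex.norm_deriv_le_of_forall_mem_sphere_norm_le (sub_pos.2 hRS)
    (hf.diffContOnCl_ball hsub) fun w hw => hM w (hsub (sphere_subset_closedBall hw))

theorem lipschitzOnWith_of_forall_mem_closedBall_norm_le (hRS : R < S)
    (hf : DifferentiableOn ℂ f (closedBall c S)) (hM : ∀ z ∈ closedBall c S, ‖f z‖ ≤ M) :
    LipschitzOnWith (M / (S - R)).toNNReal f (closedBall c R) := by
  refine (convex_closedBall c R).lipschitzOnWith_of_nnnorm_deriv_le (𝕜 := ℂ) (fun z hz => ?_)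
    fun z hz => NNReal.le_toNNReal_of_coe_le
      (norm_deriv_le_of_forall_mem_closedBall_norm_le hRS hf hM hz)
  exact hf.differentiableAt (mem_of_superset
    (isOpen_ball.mem_nhds (closedBall_subset_ball hRS hz)) ball_subset_closedBall)

end CauchyEstimates

theorem exists_mem_frontier_re_le {E : Type*} [NormedAddCommGroup E] [NormedSpace ℂ E]
    [FiniteDimensional ℂ E] [Nontrivial E] {f : E → ℂ} {U : Set E} (hU : Bornology.IsBounded U)
    (hf : DiffContOnCl ℂ f U) {z : E} (hz : z ∈ U) : ∃ w ∈ frontier U, (f w).re ≤ (f z).re := by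
  obtain ⟨w, hw, hmax⟩ := Complex.exists_mem_frontier_isMaxOn_norm hU ⟨z, hz⟩
    (Complex.differentiable_exp.comp_diffContOnCl hf.neg)
  refine ⟨w, hw, ?_⟩
  simpa [Complex.norm_exp] using hmax (subset_closure hz)

/-- Carathéodory functions: analytic in the unit disk, of positive real part, normalized by
`p 0 = 1`. -/
structure IsCaratheodory (p : ℂ → ℂ) : Prop where
  differentiableOn : DifferentiableOn ℂ p unitDisk
  map_zero : p 0 = 1
  re_pos : ∀ z ∈ unitDisk, 0 < (p z).re

theorem IsMaMindaFunction.isCaratheodory {ψ : ℂ → ℂ} (hψ : IsMaMindaFunction ψ) :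
    IsCaratheodory ψ :=
  ⟨hψ.analytic, hψ.map_zero, hψ.re_pos⟩

namespace IsCaratheodory

variable {p : ℂ → ℂ} {z : ℂ}

theorem ne_zero (hp : IsCaratheodory p) (hz : z ∈ unitDisk) : p z ≠ 0 := fun h =>
  (hp.re_pos z hz).ne' (by simp [h])

theorem inv (hp : IsCaratheodory p) : IsCaratheodory fun z => (p z)⁻¹ where
  differentiableOn := hp.differentiableOn.inv fun _ => hp.ne_zero
  map_zero := by rw [hp.map_zero, inv_one]
  re_pos z hz := by
    rw [Complex.inv_re]
    exact div_pos (hp.re_pos z hz) (Complex.normSq_pos.2 (hp.ne_zero hz))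

theorem norm_le (hp : IsCaratheodory p) (hz : z ∈ unitDisk) : ‖p z‖ ≤ 4 / (1 - ‖z‖) := by
  have hz1 : ‖z‖ < 1 := mem_ball_zero_iff.1 hz
  have h := Complex.borelCaratheodory (f := fun w => -p w) one_pos hp.differentiableOn.neg
    (fun w hw => show (-p w).re ≤ 1 by
      rw [Complex.neg_re]
      linarith [hp.re_pos w hw]) one_pos hz
  rw [norm_neg, norm_neg, hp.map_zero, norm_one, ← add_div] at h
  exact h.trans (div_le_div_of_nonneg_right (by linarith) (by linarith))

theorem norm_le_of_mem_closedBall (hp : IsCaratheodory p) {R : ℝ} (hR : R < 1)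
    (hz : z ∈ closedBall 0 R) : ‖p z‖ ≤ 4 / (1 - R) := by
  have hzR : ‖z‖ ≤ R := mem_closedBall_zero_iff.1 hz
  exact (hp.norm_le (closedBall_subset_ball hR hz)).trans
    (div_le_div_of_nonneg_left (by norm_num) (by linarith) (by linarith))

end IsCaratheodory

theorem exists_norm_add_mul_deriv_div_le {R : ℝ} (hR : R < 1) :
    ∃ M : ℝ, ∀ p, IsCaratheodory p → ∀ z ∈ closedBall (0 : ℂ) R,
      ‖p z + z * deriv p z / p z‖ ≤ M := by
  obtain ⟨S, hRS, hS⟩ := exists_between hR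
  refine ⟨4 / (1 - S) + 1 * (4 / (1 - S) / (S - R)) * (4 / (1 - S)), fun p hp z hz => ?_⟩
  have hzS : z ∈ closedBall 0 S := closedBall_subset_closedBall hRS.le hz
  have hz1 : ‖z‖ ≤ 1 := (mem_closedBall_zero_iff.1 hz).trans hR.le
  have hderiv : ‖deriv p z‖ ≤ 4 / (1 - S) / (S - R) :=
    norm_deriv_le_of_forall_mem_closedBall_norm_le hRS
      (hp.differentiableOn.mono (closedBall_subset_ball hS))
      (fun w hw => hp.norm_le_of_mem_closedBall hS hw) hz
  calc ‖p z + z * deriv p z / p z‖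
      ≤ ‖p z‖ + ‖z‖ * ‖deriv p z‖ * ‖(p z)⁻¹‖ := by
        rw [← norm_mul, ← norm_mul, ← div_eq_mul_inv]
        exact norm_add_le _ _
    _ ≤ 4 / (1 - S) + 1 * (4 / (1 - S) / (S - R)) * (4 / (1 - S)) := by
        gcongr
        · exact hp.norm_le_of_mem_closedBall hS hzS
        · exact hp.inv.norm_le_of_mem_closedBall hS hzS

section StarlikeFunctions

variable {h ψ : ℂ → ℂ} {z : ℂ}

/-- The function `1 + z h''(z) / h'(z)`, whose real part is `convexityRe h`. -/
noncomputable def convexityQuotient (h : ℂ → ℂ) (z : ℂ) : ℂ :=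
  1 + z * deriv (deriv h) z / deriv h z

/-- Normalized starlike functions: `h ∈ 𝒜` such that `z h'(z) / h(z)` has positive real part.
Every class `𝒮*(ψ)` consists of such functions. -/
structure IsStarlike (h : ℂ → ℂ) : Prop where
  mem_classA : h ∈ classA
  isCaratheodory : IsCaratheodory (starQuotient h)

theorem starQuotient_zero : starQuotient h 0 = 1 :=
  Function.update_self ..

theorem starQuotient_of_ne (hz : z ≠ 0) : starQuotient h z = z * deriv h z / h z :=
  Function.update_of_ne hz ..

theorem isStarlike_of_mem_starlikeClass (hψ : IsCaratheodory ψ) (hh : h ∈ starlikeClass ψ) :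
    IsStarlike h := by
  obtain ⟨hA, ω, hω, hmaps, -, heq⟩ := hh
  exact ⟨hA, (hψ.differentiableOn.comp hω hmaps).congr heq, starQuotient_zero,
    fun z hz => heq z hz ▸ hψ.re_pos _ (hmaps hz)⟩

theorem id_mem_starlikeClass (hψ : ψ 0 = 1) : id ∈ starlikeClass ψ := by
  refine ⟨⟨differentiableOn_id, rfl, deriv_id 0⟩, fun _ => 0, differentiableOn_const 0,
    fun _ _ => mem_ball_self one_pos, rfl, fun z _ => ?_⟩
  rw [hψ]
  rcases eq_or_ne z 0 with rfl | hz
  · exact starQuotient_zero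
  · rw [starQuotient_of_ne hz, deriv_id, mul_one, id, div_self hz]

namespace IsStarlike

theorem apply_ne_zero (hh : IsStarlike h) (hz : z ∈ unitDisk) (hz0 : z ≠ 0) : h z ≠ 0 :=
  fun h0 => hh.isCaratheodory.ne_zero hz (by rw [starQuotient_of_ne hz0, h0, div_zero])

theorem deriv_ne_zero (hh : IsStarlike h) (hz : z ∈ unitDisk) : deriv h z ≠ 0 := by
  rcases eq_or_ne z 0 with rfl | hz0
  · simp [hh.mem_classA.2.2]
  · exact fun h0 => hh.isCaratheodory.ne_zero hz
      (by rw [starQuotient_of_ne hz0, h0, mul_zero, zero_div])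

theorem convexityQuotient_eq (hh : IsStarlike h) (hz : z ∈ unitDisk) :
    convexityQuotient h z =
      starQuotient h z + z * deriv (starQuotient h) z / starQuotient h z := by
  rcases eq_or_ne z 0 with rfl | hz0
  · simp [convexityQuotient, starQuotient_zero]
  have hzn : unitDisk ∈ 𝓝 z := isOpen_ball.mem_nhds hz
  have hd : HasDerivAt h (deriv h z) z := (hh.mem_classA.1.differentiableAt hzn).hasDerivAt
  have hd' : HasDerivAt (deriv h) (deriv (deriv h) z) z :=
    ((hh.mem_classA.1.deriv isOpen_ball).differentiableAt hzn).hasDerivAt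
  have hne := hh.apply_ne_zero hz hz0
  have hne' := hh.deriv_ne_zero hz
  have heq : starQuotient h =ᶠ[𝓝 z] fun w => w * deriv h w / h w := by
    filter_upwards [isOpen_ne.mem_nhds hz0] with w hw using starQuotient_of_ne hw
  rw [((((hasDerivAt_id z).mul hd').div hd hne).congr_of_eventuallyEq heq).deriv,
    starQuotient_of_ne hz0, convexityQuotient]
  simp only [id, Pi.mul_apply]
  field_simp
  ring

theorem differentiableOn_convexityQuotient (hh : IsStarlike h) :
    DifferentiableOn ℂ (convexityQuotient h) unitDisk := by
  have hd := hh.mem_classA.1.deriv isOpen_ball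
  exact ((differentiableOn_id.mul (hd.deriv isOpen_ball)).div hd
    fun z hz => hh.deriv_ne_zero hz).const_add 1

end IsStarlike

theorem convexityRe_zero : convexityRe h 0 = 1 := by
  simp [convexityRe]

theorem exists_lipschitzOnWith_convexityRe {R : ℝ} (hR : R < 1) :
    ∃ L : ℝ≥0, ∀ h, IsStarlike h → LipschitzOnWith L (convexityRe h) (closedBall 0 R) := by
  obtain ⟨S, hRS, hS⟩ := exists_between hR
  obtain ⟨M, hM⟩ := exists_norm_add_mul_deriv_div_le hS
  refine ⟨1 * (M / (S - R)).toNNReal, fun h hh => ?_⟩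
  refine (Complex.reCLM_nnnorm ▸ Complex.reCLM.lipschitz).comp_lipschitzOnWith
    (g := convexityQuotient h)
    (lipschitzOnWith_of_forall_mem_closedBall_norm_le hRS
      (hh.differentiableOn_convexityQuotient.mono (closedBall_subset_ball hS)) fun z hz => ?_)
  rw [hh.convexityQuotient_eq (closedBall_subset_ball hS hz)]
  exact hM _ hh.isCaratheodory z hz

theorem IsStarlike.exists_mem_sphere_convexityRe_le_one (hh : IsStarlike h) {r : ℝ}
    (hr : r ∈ Ioo 0 1) : ∃ z ∈ sphere 0 r, convexityRe h z ≤ 1 := by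
  have hd : DiffContOnCl ℂ (convexityQuotient h) (ball 0 r) :=
    hh.differentiableOn_convexityQuotient.diffContOnCl_ball (closedBall_subset_ball hr.2)
  obtain ⟨z, hz, hle⟩ := exists_mem_frontier_re_le isBounded_ball hd (mem_ball_self hr.1)
  rw [frontier_ball _ hr.1.ne'] at hz
  exact ⟨z, hz, hle.trans_eq convexityRe_zero⟩

theorem exists_isMinimalRoot_sphereInf_convexityRe {𝓗 : Set (ℂ → ℂ)} (hne : 𝓗.Nonempty)
    (h𝓗 : ∀ h ∈ 𝓗, IsStarlike h) : ∃ r₀, IsMinimalRoot (sphereInf (convexityRe '' 𝓗)) r₀ := by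
  obtain ⟨L, hL⟩ := exists_lipschitzOnWith_convexityRe (R := 1 / 2) (by norm_num)
  have h0 : ∀ u ∈ convexityRe '' 𝓗, u 0 = 1 := forall_mem_image.2 fun h _ => convexityRe_zero
  have hlip : ∀ u ∈ convexityRe '' 𝓗, LipschitzOnWith L u (closedBall 0 (1 / 2)) :=
    forall_mem_image.2 fun h hh => hL h (h𝓗 h hh)
  refine exists_isMinimalRoot (lipschitzOnWith_sphereInf (hne.image _) h0 hlip).continuousOn
    (by rw [sphereInf_zero (hne.image _) h0]; exact one_pos) ?_
  obtain ⟨h, hh⟩ := hne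
  obtain ⟨z, hz, hle⟩ := (h𝓗 h hh).exists_mem_sphere_convexityRe_le_one (r := 1 / 2) (by norm_num)
  exact (sphereInf_le h0 hlip (mem_image_of_mem _ hh) le_rfl hz).trans hle

theorem exists_isMinimalRoot_classConvexityMin (hψ : IsCaratheodory ψ) :
    ∃ r₀, IsMinimalRoot (classConvexityMin ψ) r₀ := by
  have heq : classConvexityMin ψ = sphereInf (convexityRe '' starlikeClass ψ) := by
    ext r
    simp [classConvexityMin, sphereInf]
  rw [heq]
  exact exists_isMinimalRoot_sphereInf_convexityRe ⟨_, id_mem_starlikeClass hψ.map_zero⟩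
    fun h => isStarlike_of_mem_starlikeClass hψ

theorem IsStarlike.exists_isMinimalRoot_convexityMin (hh : IsStarlike h) :
    ∃ r₀, IsMinimalRoot (convexityMin h) r₀ := by
  have heq : convexityMin h = sphereInf (convexityRe '' {h}) := by
    ext r
    simp [convexityMin, sphereInf, image, eq_comm]
  rw [heq]
  exact exists_isMinimalRoot_sphereInf_convexityRe (singleton_nonempty h)
    fun _ hmem => mem_singleton_iff.1 hmem ▸ hh

end StarlikeFunctions

section InverseFunctions

variable {h : ℂ → ℂ} {U : Set ℂ} {z : ℂ}

theorem hasStrictDerivAt_invFunOn (hU : IsOpen U) (hd : DifferentiableOn ℂ h U) (hi : InjOn h U)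
    (hz : z ∈ U) (hne : deriv h z ≠ 0) :
    HasStrictDerivAt (Function.invFunOn h U) (deriv h z)⁻¹ (h z) := by
  refine (hd.analyticAt (hU.mem_nhds hz)).hasStrictDerivAt.to_local_left_inverse hne ?_
  filter_upwards [hU.mem_nhds hz] with w hw using hi.leftInvOn_invFunOn hw

theorem differentiableOn_invFunOn (hU : IsOpen U) (hd : DifferentiableOn ℂ h U) (hi : InjOn h U)
    (hne : ∀ z ∈ U, deriv h z ≠ 0) : DifferentiableOn ℂ (Function.invFunOn h U) (h '' U) := by
  rintro _ ⟨z, hz, rfl⟩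
  exact (hasStrictDerivAt_invFunOn hU hd hi hz (hne z hz)).hasDerivAt.differentiableAt
    |>.differentiableWithinAt

theorem isOpen_image_of_deriv_ne_zero (hU : IsOpen U) (hd : DifferentiableOn ℂ h U)
    (hne : ∀ z ∈ U, deriv h z ≠ 0) : IsOpen (h '' U) := by
  refine isOpen_iff_mem_nhds.2 ?_
  rintro _ ⟨z, hz, rfl⟩
  rw [← (hd.analyticAt (hU.mem_nhds hz)).hasStrictDerivAt.map_nhds_eq (hne z hz)]
  exact image_mem_map (hU.mem_nhds hz)

end InverseFunctions

section ConvexUnivalence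

variable {h u ψ : ℂ → ℂ} {z₁ z₂ : ℂ} {r R ρ : ℝ}

theorem apply_mem_image_closedBall_of_mapsTo (hd : DifferentiableOn ℂ h (ball 0 R))
    (hi : InjOn h (ball 0 R)) (hne : ∀ z ∈ ball 0 R, deriv h z ≠ 0)
    (hu : DifferentiableOn ℂ u (ball 0 R)) (hmaps : MapsTo u (ball 0 R) (h '' ball 0 R))
    (h0 : u 0 = h 0) {z : ℂ} (hz : z ∈ ball 0 R) : u z ∈ h '' closedBall 0 ‖z‖ := by
  set v := Function.invFunOn h (ball 0 R)
  have hv : DifferentiableOn ℂ v (h '' ball 0 R) := differentiableOn_invFunOn isOpen_ball hd hi hne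
  have hvmaps : MapsTo v (h '' ball 0 R) (ball 0 R) := fun w hw => Function.invFunOn_mem hw
  have hv0 : (v ∘ u) 0 = 0 := by
    rw [Function.comp_apply, h0]
    exact hi.leftInvOn_invFunOn (mem_ball_self (dist_nonneg.trans_lt hz))
  have hschwarz : ‖(v ∘ u) z‖ ≤ ‖z‖ :=
    Complex.norm_le_norm_of_mapsTo_ball (hv.comp hu hmaps)
      ((hvmaps.comp hmaps).mono_right ball_subset_closedBall) hv0 (mem_ball_zero_iff.1 hz)
  exact ⟨v (u z), mem_closedBall_zero_iff.2 hschwarz, Function.invFunOn_eq (hmaps hz)⟩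

theorem add_smul_mem_image_closedBall (hd : DifferentiableOn ℂ h (ball 0 R))
    (hne : ∀ z ∈ ball 0 R, deriv h z ≠ 0) (hh : IsConvexUnivalentOn h R) (hle : ‖z₁‖ ≤ ‖z₂‖)
    (hz₂ : z₂ ∈ ball 0 R) {a b : ℝ} (ha : 0 ≤ a) (hb : 0 ≤ b) (hab : a + b = 1) :
    a • h z₁ + b • h z₂ ∈ h '' closedBall 0 ‖z₂‖ := by
  -- `z ↦ a h(z z₁ / z₂) + b h(z)` is subordinate to `h`, and its value at `z₂` is the given point.
  have hrot : MapsTo (fun z => z * (z₁ / z₂)) (ball 0 R) (ball 0 R) := fun z hz => by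
    rw [mem_ball_zero_iff] at hz ⊢
    have hquot : ‖z₁ / z₂‖ ≤ 1 := by
      rw [norm_div]
      exact div_le_one_of_le₀ hle (norm_nonneg z₂)
    exact (norm_mul_le _ _).trans_lt
      ((mul_le_of_le_one_right (norm_nonneg z) hquot).trans_lt hz)
  have hcancel : z₂ * (z₁ / z₂) = z₁ := by
    rcases eq_or_ne z₂ 0 with rfl | hne'
    · simpa [eq_comm] using hle
    · exact mul_div_cancel₀ z₁ hne'
  have hmem := apply_mem_image_closedBall_of_mapsTo (u := fun z => a • h (z * (z₁ / z₂)) + b • h z)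
    hd hh.1 hne (((hd.comp (by fun_prop) hrot).const_smul a).add (hd.const_smul b))
    (fun z hz => hh.2 (mem_image_of_mem h (hrot hz)) (mem_image_of_mem h hz) ha hb hab)
    (by simp only [zero_mul]; rw [← add_smul, hab, one_smul]) hz₂
  simpa only [hcancel] using hmem

theorem IsConvexUnivalentOn.mono (hd : DifferentiableOn ℂ h (ball 0 R))
    (hne : ∀ z ∈ ball 0 R, deriv h z ≠ 0) (hh : IsConvexUnivalentOn h R) (hrR : r ≤ R) :
    IsConvexUnivalentOn h r := by
  have hcomb : ∀ z₁ z₂, ‖z₁‖ ≤ ‖z₂‖ → z₂ ∈ ball 0 r → ∀ a b : ℝ, 0 ≤ a → 0 ≤ b → a + b = 1 →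
      a • h z₁ + b • h z₂ ∈ h '' ball 0 r := fun z₁ z₂ hle hz₂ a b ha hb hab =>
    image_mono (closedBall_subset_ball (mem_ball_zero_iff.1 hz₂))
      (add_smul_mem_image_closedBall hd hne hh hle (ball_subset_ball hrR hz₂) ha hb hab)
  refine ⟨hh.1.mono (ball_subset_ball hrR), ?_⟩
  rintro _ ⟨z₁, hz₁, rfl⟩ _ ⟨z₂, hz₂, rfl⟩ a b ha hb hab
  rcases le_total ‖z₁‖ ‖z₂‖ with hle | hle
  · exact hcomb z₁ z₂ hle hz₂ a b ha hb hab
  · rw [add_comm]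
    exact hcomb z₂ z₁ hle hz₁ b a hb ha ((add_comm b a).trans hab)

theorem isConvexUnivalentOn_of_forall_lt (hh : ∀ r < ρ, IsConvexUnivalentOn h r) :
    IsConvexUnivalentOn h ρ := by
  have hball : ball (0 : ℂ) ρ = ⋃ r : Iio ρ, ball 0 r.1 := by
    rw [← biUnion_lt_ball, iUnion_subtype]
    rfl
  have hmono : Monotone fun r : Iio ρ => ball (0 : ℂ) r.1 := fun r s hrs => ball_subset_ball hrs
  rw [IsConvexUnivalentOn, hball, image_iUnion]
  refine ⟨inj_on_iUnion_of_directed hmono.directed_le fun r => (hh r r.2).1, ?_⟩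
  exact Directed.convex_iUnion (Monotone.directed_le fun r s hrs => image_mono (hmono hrs))
    fun {r} => (hh r r.2).2

theorem isConvexUnivalentOn_of_le_radiusOfConvexity (hψ : IsCaratheodory ψ)
    (hh : h ∈ starlikeClass ψ) (hρ : ρ ≤ radiusOfConvexity ψ) : IsConvexUnivalentOn h ρ := by
  refine isConvexUnivalentOn_of_forall_lt fun r hr => ?_
  have hnonempty : {r | r ∈ Icc (0 : ℝ) 1 ∧
      ∀ h ∈ starlikeClass ψ, IsConvexUnivalentOn h r}.Nonempty :=
    ⟨0, by simp, fun h _ => by simp [IsConvexUnivalentOn, convex_empty]⟩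
  obtain ⟨R, ⟨hR, hconvex⟩, hrR⟩ := exists_lt_of_lt_csSup hnonempty (hr.trans_le hρ)
  have hsub : ball 0 R ⊆ unitDisk := ball_subset_ball hR.2
  exact (hconvex h hh).mono (hh.1.1.mono hsub)
    (fun z hz => (isStarlike_of_mem_starlikeClass hψ hh).deriv_ne_zero (hsub hz)) hrR.le

end ConvexUnivalence

section HarmonicMappings

variable {h g φ ψ : ℂ → ℂ} {U : Set ℂ} {z : ℂ} {k : ℝ≥0}

theorem det_eq_re_mul_im_sub (L : ℂ →L[ℝ] ℂ) :
    L.det = (L 1).re * (L Complex.I).im - (L Complex.I).re * (L 1).im := by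
  rw [ContinuousLinearMap.det, ← LinearMap.det_toMatrix Complex.basisOneI, Matrix.det_fin_two]
  simp [LinearMap.toMatrix_apply]

theorem det_fderiv_add_conj (hh : DifferentiableAt ℂ h z) (hg : DifferentiableAt ℂ g z) :
    (fderiv ℝ (fun z => h z + (starRingEnd ℂ) (g z)) z).det =
      ‖deriv h z‖ ^ 2 - ‖deriv g z‖ ^ 2 := by
  have hh' : HasFDerivAt h (deriv h z • (1 : ℂ →L[ℝ] ℂ)) z := hh.hasDerivAt.complexToReal_fderiv
  have hg' : HasFDerivAt g (deriv g z • (1 : ℂ →L[ℝ] ℂ)) z := hg.hasDerivAt.complexToReal_fderiv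
  have hfderiv : fderiv ℝ (fun z => h z + (starRingEnd ℂ) (g z)) z = _ :=
    (hh'.add (Complex.conjCLE.toContinuousLinearMap.hasFDerivAt.comp z hg')).fderiv
  rw [hfderiv, det_eq_re_mul_im_sub, ← Complex.normSq_eq_norm_sq, ← Complex.normSq_eq_norm_sq,
    Complex.normSq_apply, Complex.normSq_apply]
  simp
  ring

theorem harmonicOnNhd_add_conj (hU : IsOpen U) (hh : DifferentiableOn ℂ h U)
    (hg : DifferentiableOn ℂ g U) :
    InnerProductSpace.HarmonicOnNhd (fun z => h z + (starRingEnd ℂ) (g z)) U := fun _ hz =>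
  (hh.analyticAt (hU.mem_nhds hz)).harmonicAt.add
    ((hg.analyticAt (hU.mem_nhds hz)).harmonicAt.comp_CLM Complex.conjCLE.toContinuousLinearMap)

theorem lipschitzOnWith_comp_invFunOn (hU : IsOpen U) (hh : DifferentiableOn ℂ h U)
    (hg : DifferentiableOn ℂ g U) (hi : InjOn h U) (hconv : Convex ℝ (h '' U))
    (hne : ∀ z ∈ U, deriv h z ≠ 0) (hk : ∀ z ∈ U, ‖deriv g z‖ ≤ k * ‖deriv h z‖) :
    LipschitzOnWith k (g ∘ Function.invFunOn h U) (h '' U) := by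
  have hderiv : ∀ z ∈ U,
      HasDerivAt (g ∘ Function.invFunOn h U) (deriv g z * (deriv h z)⁻¹) (h z) := fun z hz => by
    refine HasDerivAt.comp (h z) ?_ (hasStrictDerivAt_invFunOn hU hh hi hz (hne z hz)).hasDerivAt
    rw [hi.leftInvOn_invFunOn hz]
    exact (hg.differentiableAt (hU.mem_nhds hz)).hasDerivAt
  refine hconv.lipschitzOnWith_of_nnnorm_deriv_le (𝕜 := ℂ)
    (forall_mem_image.2 fun z hz => (hderiv z hz).differentiableAt)
    (forall_mem_image.2 fun z hz => ?_)
  rw [(hderiv z hz).deriv, ← NNReal.coe_le_coe, coe_nnnorm, ← div_eq_mul_inv, norm_div]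
  exact div_le_of_le_mul₀ (norm_nonneg _) k.2 (hk z hz)

theorem isUnivalentCloseToConvexOn_add_conj (hU : IsOpen U) (hh : DifferentiableOn ℂ h U)
    (hg : DifferentiableOn ℂ g U) (hi : InjOn h U) (hconv : Convex ℝ (h '' U))
    (hne : ∀ z ∈ U, deriv h z ≠ 0) (hk1 : k < 1) (hk : ∀ z ∈ U, ‖deriv g z‖ ≤ k * ‖deriv h z‖) :
    IsUnivalentCloseToConvexOn (fun z => h z + (starRingEnd ℂ) (g z)) U := by
  set T : ℂ → ℂ := fun w => (starRingEnd ℂ) (g (Function.invFunOn h U w))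
  have hT : LipschitzOnWith k T (h '' U) := by
    rw [← one_mul k]
    exact Complex.isometry_conj.lipschitz.comp_lipschitzOnWith
      (lipschitzOnWith_comp_invFunOn hU hh hg hi hconv hne hk)
  have hfactor : EqOn ((fun w => w + T w) ∘ h) (fun z => h z + (starRingEnd ℂ) (g z)) U :=
    fun z hz => by simp only [T, Function.comp_apply, hi.leftInvOn_invFunOn hz]
  refine ⟨harmonicOnNhd_add_conj hU hh hg, ?_, fun z hz => ?_, ?_⟩
  · exact ((injOn_add_of_lipschitzOnWith hk1 hT).comp hi (mapsTo_image h U)).congr hfactor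
  · have hlt : ‖deriv g z‖ < ‖deriv h z‖ :=
      (hk z hz).trans_lt (mul_lt_of_lt_one_left (norm_pos_iff.2 (hne z hz)) hk1)
    rw [det_fderiv_add_conj (hh.differentiableAt (hU.mem_nhds hz))
      (hg.differentiableAt (hU.mem_nhds hz)), sub_pos]
    gcongr
  · rw [← hfactor.image_eq, image_comp]
    exact isCloseToConvexDomain_image_add hconv (isOpen_image_of_deriv_ne_zero hU hh hne) hk1 hT

theorem exists_forall_norm_le_mul_of_norm_lt {X E F : Type*} [TopologicalSpace X]
    [SeminormedAddCommGroup E] [SeminormedAddCommGroup F] {a : X → E} {b : X → F} {K : Set X}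
    (hK : IsCompact K) (ha : ContinuousOn a K) (hb : ContinuousOn b K)
    (hlt : ∀ x ∈ K, ‖a x‖ < ‖b x‖) : ∃ k : ℝ≥0, k < 1 ∧ ∀ x ∈ K, ‖a x‖ ≤ k * ‖b x‖ := by
  rcases K.eq_empty_or_nonempty with rfl | hne
  · exact ⟨0, one_pos, by simp⟩
  have hpos : ∀ x ∈ K, 0 < ‖b x‖ := fun x hx => (norm_nonneg _).trans_lt (hlt x hx)
  obtain ⟨x₀, hx₀, hmax⟩ := hK.exists_isMaxOn hne
    (ha.norm.div hb.norm fun x hx => (hpos x hx).ne')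
  refine ⟨⟨‖a x₀‖ / ‖b x₀‖, by positivity⟩, (div_lt_one (hpos x₀ hx₀)).2 (hlt x₀ hx₀),
    fun x hx => (div_le_iff₀ (hpos x hx)).1 (hmax hx)⟩

theorem IsStarlike.norm_deriv_lt (hh : IsStarlike h) (hφ : MapsTo φ unitDisk unitDisk)
    (hgφ : ∀ z ∈ unitDisk, deriv g z = φ z * deriv h z) (hz : z ∈ unitDisk) :
    ‖deriv g z‖ < ‖deriv h z‖ := by
  rw [hgφ z hz, norm_mul]
  exact mul_lt_of_lt_one_left (norm_pos_iff.2 (hh.deriv_ne_zero hz)) (mem_ball_zero_iff.1 (hφ hz))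

theorem isUnivalentCloseToConvexOn_of_le_radiusOfConvexity (hψ : IsCaratheodory ψ)
    (hh : h ∈ starlikeClass ψ) (hg : DifferentiableOn ℂ g unitDisk)
    (hlt : ∀ z ∈ unitDisk, ‖deriv g z‖ < ‖deriv h z‖) {ρ : ℝ} (hρ1 : ρ < 1)
    (hρ : ρ ≤ radiusOfConvexity ψ) :
    IsUnivalentCloseToConvexOn (fun z => h z + (starRingEnd ℂ) (g z)) (ball 0 ρ) := by
  have hK : closedBall 0 ρ ⊆ unitDisk := closedBall_subset_ball hρ1
  have hsub : ball 0 ρ ⊆ unitDisk := ball_subset_ball hρ1.le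
  obtain ⟨hi, hconv⟩ := isConvexUnivalentOn_of_le_radiusOfConvexity hψ hh hρ
  obtain ⟨k, hk1, hk⟩ := exists_forall_norm_le_mul_of_norm_lt (isCompact_closedBall 0 ρ)
    ((hg.deriv isOpen_ball).continuousOn.mono hK) ((hh.1.1.deriv isOpen_ball).continuousOn.mono hK)
    fun z hz => hlt z (hK hz)
  exact isUnivalentCloseToConvexOn_add_conj isOpen_ball (hh.1.1.mono hsub) (hg.mono hsub) hi hconv
    (fun z hz => (isStarlike_of_mem_starlikeClass hψ hh).deriv_ne_zero (hsub hz)) hk1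
    fun z hz => hk z (ball_subset_closedBall hz)

end HarmonicMappings

theorem mainTheorem7_general {ψ : ℂ → ℂ} (hψ : IsCaratheodory ψ) :
    (∃ r₀, IsMinimalRoot (classConvexityMin ψ) r₀) ∧
    ∀ h ∈ starlikeClass ψ, (∃ r₀, IsMinimalRoot (convexityMin h) r₀) ∧
      ∀ g : ℂ → ℂ, DifferentiableOn ℂ g unitDisk →
        (∀ z ∈ unitDisk, ‖deriv g z‖ < ‖deriv h z‖) →
        ∀ ρ < 1, ρ ≤ radiusOfConvexity ψ →
          IsUnivalentCloseToConvexOn (fun z => h z + (starRingEnd ℂ) (g z)) (ball 0 ρ) :=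
  ⟨exists_isMinimalRoot_classConvexityMin hψ, fun _ hh =>
    ⟨(isStarlike_of_mem_starlikeClass hψ hh).exists_isMinimalRoot_convexityMin, fun _ hg hlt _ =>
      isUnivalentCloseToConvexOn_of_le_radiusOfConvexity hψ hh hg hlt⟩⟩

end MaMinda

theorem mainTheorem7 (ψ : ℂ → ℂ) (hψ : MaMinda.IsMaMindaFunction ψ) :
    (∃ r₀ : ℝ, MaMinda.IsMinimalRoot (MaMinda.classConvexityMin ψ) r₀ ∧
      ∀ h ∈ MaMinda.starlikeClass ψ, ∀ φ g : ℂ → ℂ,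
        DifferentiableOn ℂ φ MaMinda.unitDisk →
        MapsTo φ MaMinda.unitDisk MaMinda.unitDisk →
        DifferentiableOn ℂ g MaMinda.unitDisk →
        (∀ z ∈ MaMinda.unitDisk, deriv g z = φ z * deriv h z) →
        MaMinda.IsUnivalentCloseToConvexOn (fun z => h z + (starRingEnd ℂ) (g z))
          (ball 0 (min r₀ (MaMinda.radiusOfConvexity ψ)))) ∧
    (∀ h ∈ MaMinda.starlikeClass ψ,
      ∃ r₀ : ℝ, MaMinda.IsMinimalRoot (MaMinda.convexityMin h) r₀ ∧
      ∀ φ g : ℂ → ℂ,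
        DifferentiableOn ℂ φ MaMinda.unitDisk →
        MapsTo φ MaMinda.unitDisk MaMinda.unitDisk →
        DifferentiableOn ℂ g MaMinda.unitDisk →
        (∀ z ∈ MaMinda.unitDisk, deriv g z = φ z * deriv h z) →
        MaMinda.IsUnivalentCloseToConvexOn (fun z => h z + (starRingEnd ℂ) (g z))
          (ball 0 (min r₀ (MaMinda.radiusOfConvexity ψ)))) := by
  obtain ⟨⟨r₀, hr₀⟩, hclass⟩ := MaMinda.mainTheorem7_general hψ.isCaratheodory
  have hlt {h φ g} (hh : h ∈ MaMinda.starlikeClass ψ) hφ hgφ z hz :=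
    (MaMinda.isStarlike_of_mem_starlikeClass hψ.isCaratheodory hh).norm_deriv_lt
      (φ := φ) (g := g) (z := z) hφ hgφ hz
  refine ⟨⟨r₀, hr₀, fun h hh φ g _ hφ hg hgφ => ?_⟩, fun h hh => ?_⟩
  · exact (hclass h hh).2 g hg (hlt hh hφ hgφ) _
      ((min_le_left _ _).trans_lt hr₀.1.1.2) (min_le_right _ _)
  · obtain ⟨⟨r₁, hr₁⟩, hmap⟩ := hclass h hh
    exact ⟨r₁, hr₁, fun φ g _ hφ hg hgφ => hmap g hg (hlt hh hφ hgφ) _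
      ((min_le_left _ _).trans_lt hr₁.1.1.2) (min_le_right _ _)⟩
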